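/- **Theorem 1.** Let $n\ge 1$ and, for each site $i\in\{1,\dots,n\}$, let $X_i$ be a set, $|s_i|$ a natural number, $\phi_i:X_i\to\mathbb{R}^{|s_i|}$ a (local feature) map with components $\phi_i^{s}$, and $\sigma_i\in\mathbb{R}$. For bond dimensions $\alpha_1,\dots,\alpha_n\ge 1$, with the cyclic convention $\alpha_{n+1}=\alpha_1$, let $A_i=(A^{s}_{i;\,ab})$, $1\le s\le|s_i|$, $1\le a\le\alpha_i$, $1\le b\le\alpha_{i+1}$, be random tensors all of whose entries are independent Gaussian variables with mean $0$ and variance $\sigma_i^2/\sqrt{\alpha_i\alpha_{i+1}}$ at site $i$. For $\mathbf{x}=(x_1,\dots,x_n)\in X_1\times\cdots\times X_n$ define the output of the matrix product state (MPS) by $$\Psi(\mathbf{x})=\sum_{s_1,\dots,s_n}\ \sum_{a_1,\dots,a_n}A^{s_1}_{1;\,a_1a_2}\cdots A^{s_i}_{i;\,a_ia_{i+1}}\cdots A^{s_n}_{n;\,a_na_1}\ \prod_{i=1}^n\phi_i^{s_i}(x_i).$$ Then there is a Gaussian process $G$ indexed by $X_1\times\cdots\times X_n$ with mean $0$ and covariance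 function $$\Sigma(\mathbf{x},\mathbf{x}')=\prod_{i=1}^n\sigma_i^2\,\phi_i(x_i)\cdot\phi_i(x'_i)$$ such that, for every finite data set $\mathbf{x}^{(1)},\dots,\mathbf{x}^{(m)}$, the vector $(\Psi(\mathbf{x}^{(1)}),\dots,\Psi(\mathbf{x}^{(m)}))$ converges in distribution to $(G(\mathbf{x}^{(1)}),\dots,G(\mathbf{x}^{(m)}))$ as the bond dimensions go to infinity sequentially. That is, if $\alpha_1,\dots,\alpha_n$ are sent to infinity one after the other, in any order, each while the remaining ones are held fixed, then every successive limit in distribution exists, and the last one is the law of $(G(\mathbf{x}^{(1)}),\dots,G(\mathbf{x}^{(m)}))$. -/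

import Mathlib

open MeasureTheory ProbabilityTheory Filter Topology

noncomputable section

namespace MPS

variable {n : ℕ} [NeZero n]

/-- The positions of the entries of the tensors of a matrix product state with `n` sites and
periodic boundary. At site `i` the physical index has `d i` values, the left bond index has `α i`
values, and the right bond index has `α (i + 1)` values; addition in `Fin n` is cyclic, so the
right bond of the last site is the left bond of the first one. -/
abbrev Entry (d α : Fin n → ℕ) : Type :=
  (i : Fin n) × (Fin (d i) × Fin (α i) × Fin (α (i + 1)))

/-- All the tensors `A i` together; the entry of `A i` with physical index `s` and bond
indices `a`, `b` is `A ⟨i, s, a, b⟩`. -/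
abbrev Tensors (d α : Fin n → ℕ) : Type := Entry d α → ℝ

/-- The output of the matrix product state with tensors `A` on the input `x`: the contraction
over all physical indices `s` and all bond indices `a` of the tensors with the product
feature vector of `x`. -/
def output {X : Fin n → Type*} {d : Fin n → ℕ} (φ : ∀ i, X i → Fin (d i) → ℝ)
    {α : Fin n → ℕ} (A : Tensors d α) (x : ∀ i, X i) : ℝ :=
  ∑ s : (∀ i, Fin (d i)), ∑ a : (∀ i, Fin (α i)),
    (∏ i, A ⟨i, s i, a i, a (i + 1)⟩) * ∏ i, φ i (x i) (s i)

/-- The variance of every entry of the tensor at site `i`. -/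
def entryVariance (σ : Fin n → ℝ) (α : Fin n → ℕ) (i : Fin n) : ℝ :=
  σ i ^ 2 / √((α i : ℝ) * (α (i + 1) : ℝ))

/-- The law of the random tensors: all entries are independent centered Gaussians, those of the
tensor at site `i` with variance `entryVariance σ α i`. -/
def tensorLaw (d : Fin n → ℕ) (σ : Fin n → ℝ) (α : Fin n → ℕ) :
    ProbabilityMeasure (Tensors d α) :=
  ⟨Measure.pi fun e => gaussianReal 0 (entryVariance σ α e.1).toNNReal, inferInstance⟩

lemma measurable_output {X : Fin n → Type*} {d : Fin n → ℕ} (φ : ∀ i, X i → Fin (d i) → ℝ)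
    (α : Fin n → ℕ) {m : ℕ} (x : Fin m → ∀ i, X i) :
    Measurable fun (A : Tensors d α) (k : Fin m) => output φ A (x k) := by
  unfold output
  fun_prop

/-- The joint law of the outputs on the inputs `x 0, …, x (m - 1)`, for random tensors with
bond dimensions `α`. -/
def outputLaw {X : Fin n → Type*} {d : Fin n → ℕ} (φ : ∀ i, X i → Fin (d i) → ℝ)
    (σ : Fin n → ℝ) {m : ℕ} (x : Fin m → ∀ i, X i) (α : Fin n → ℕ) :
    ProbabilityMeasure (Fin m → ℝ) :=
  (tensorLaw d σ α).map (measurable_output φ α x).aemeasurable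

/-- The limit covariance function. -/
def limitCov {X : Fin n → Type*} {d : Fin n → ℕ} (φ : ∀ i, X i → Fin (d i) → ℝ)
    (σ : Fin n → ℝ) (x x' : ∀ i, X i) : ℝ :=
  ∏ i, (σ i ^ 2 * (φ i (x i) ⬝ᵥ φ i (x' i)))

/-- `SeqTendsto l f L`: the iterated limit of `f α` is `L` when the coordinates of `α` in the list
`l` go to infinity one after the other, the head of `l` first (with all the other coordinates held
fixed at positive values). Every intermediate limit is required to exist, and the last one has to
be `L` whatever the starting values of the coordinates. -/
def SeqTendsto {Y : Type*} [TopologicalSpace Y] :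
    List (Fin n) → ((Fin n → ℕ) → Y) → Y → Prop
  | [], f, L => ∀ α : Fin n → ℕ, (∀ i, 0 < α i) → f α = L
  | j :: l, f, L => ∃ g : (Fin n → ℕ) → Y,
      (∀ α : Fin n → ℕ, (∀ i, 0 < α i) →
        Tendsto (fun N : ℕ => f (Function.update α j N)) atTop (𝓝 (g α))) ∧
      SeqTendsto l g L

/-- Evaluation of a path at finitely many inputs is measurable. -/
lemma measurable_eval {T : Type*} {m : ℕ} (x : Fin m → T) :
    Measurable fun (ω : T → ℝ) (k : Fin m) => ω (x k) := by
  fun_prop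

end MPS

end

/-! Send the bond `j`, between the sites `p` and `j`, to infinity with all other bonds fixed. Given
the other tensors, a linear combination of the outputs is a bilinear form
$N^{-1/2}\sum_{c<N}\sum_{x,y}h(x,y)\,u_{x,c}v_{y,c}$ in the tensors `u` at `p` and `v` at `j`. Given
`u` as well, it is Gaussian with variance $N^{-1}\sum_c\sum_y(\sum_x h(x,y)u_{x,c})^2$, which tends
almost surely to $\sum_{x,y}h(x,y)^2$ by the law of large numbers. This is the variance of
$\sum_{x,y}h(x,y)w_{x,y}$ with fresh independent standard Gaussians `w`
(`tendsto_integral_bilinear`).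

Hence the limit law is exactly the law of a shorter network, where `p` and `j` are fused into one
site whose physical index is a pair and whose feature vector is a tensor product (`Network.merge`,
`Network.tendsto_law`). Iteration leaves a single site closed on itself. Its output is
$\alpha^{-1/2}$ times the trace of a Gaussian matrix, so it is exactly Gaussian for every positive
bond dimension. Fusion preserves the product of the Gram matrices of the features
(`Network.prod_gram_merge`), so the final covariance does not depend on the order of the limits
(`Network.seqTendsto_law`).

All networks read their entries from one standard Gaussian family indexed by site, physical index
and two bond values, independently of the bond dimensions. In the matrix product state every bond is
shared by two tensors, so the prescribed variances give a factor $\alpha^{-1/2}$ per bond, the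
scaling of the central limit theorem (`prod_entryScale`). -/

noncomputable section

namespace MPS

/-- The law of a family of independent standard Gaussian variables. -/
def stdGaussianFamily (ι : Type*) : Measure (ι → ℝ) :=
  Measure.infinitePi fun _ => gaussianReal 0 1

instance {ι : Type*} : IsProbabilityMeasure (stdGaussianFamily ι) := by
  unfold stdGaussianFamily; infer_instance

/-! ### Linear combinations of independent standard Gaussians. -/

section Gaussian

variable {ι κ : Type*}

lemma iIndepFun_eval : iIndepFun (fun (i : ι) (ω : ι → ℝ) => ω i) (stdGaussianFamily ι) :=
  iIndepFun_infinitePi (X := fun _ x => x) fun _ => measurable_id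

lemma map_eval (i : ι) : (stdGaussianFamily ι).map (fun ω => ω i) = gaussianReal 0 1 :=
  Measure.infinitePi_map_eval _ i

lemma hasGaussianLaw_eval (i : ι) :
    HasGaussianLaw (fun ω : ι → ℝ => ω i) (stdGaussianFamily ι) where
  isGaussian_map := by rw [map_eval]; infer_instance

lemma memLp_eval (i : ι) : MemLp (fun ω : ι → ℝ => ω i) 2 (stdGaussianFamily ι) :=
  (hasGaussianLaw_eval i).memLp_two

lemma integral_eval (i : ι) : ∫ ω, ω i ∂(stdGaussianFamily ι) = 0 := by
  have h := integral_map (μ := stdGaussianFamily ι) (φ := fun ω : ι → ℝ => ω i)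
    (f := fun x : ℝ => x) (Measurable.aemeasurable (by fun_prop)) (by fun_prop)
  rw [← h, map_eval]
  simp

lemma variance_eval (i : ι) : Var[fun ω : ι → ℝ => ω i; stdGaussianFamily ι] = 1 := by
  have h := variance_map (μ := stdGaussianFamily ι) (Y := fun ω : ι → ℝ => ω i)
    (X := fun x : ℝ => x) (by fun_prop) (Measurable.aemeasurable (by fun_prop))
  rw [map_eval] at h
  simpa [Function.comp_def] using h.symm

lemma covariance_eval_of_ne {i j : ι} (h : i ≠ j) :
    cov[fun ω : ι → ℝ => ω i, fun ω => ω j; stdGaussianFamily ι] = 0 :=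
  (iIndepFun_eval.indepFun h).covariance_eq_zero (memLp_eval i) (memLp_eval j)

/-- The covariance of two linear combinations of independent standard Gaussian variables. -/
lemma covariance_linear (E : Finset κ) {g : κ → ι} (hg : Function.Injective g) (y z : κ → ℝ) :
    cov[fun ω : ι → ℝ => ∑ e ∈ E, y e * ω (g e), fun ω => ∑ e ∈ E, z e * ω (g e);
      stdGaussianFamily ι] = ∑ e ∈ E, y e * z e := by
  rw [covariance_fun_sum_fun_sum' (fun e _ => (memLp_eval (g e)).const_mul (y e))
    (fun e _ => (memLp_eval (g e)).const_mul (z e))]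
  refine Finset.sum_congr rfl fun e he => ?_
  rw [Finset.sum_eq_single e]
  · rw [covariance_const_mul_left, covariance_const_mul_right,
      covariance_self (Measurable.aemeasurable (by fun_prop)), variance_eval, mul_one]
  · intro e' _ hne
    rw [covariance_const_mul_left, covariance_const_mul_right,
      covariance_eval_of_ne (hg.ne hne.symm), mul_zero, mul_zero]
  · exact fun h => absurd he h

lemma memLp_linear (E : Finset κ) (g : κ → ι) (y : κ → ℝ) :
    MemLp (fun ω : ι → ℝ => ∑ e ∈ E, y e * ω (g e)) 2 (stdGaussianFamily ι) :=
  memLp_finsetSum E fun e _ => (memLp_eval (g e)).const_mul (y e)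

lemma integral_linear (E : Finset κ) (g : κ → ι) (y : κ → ℝ) :
    ∫ ω, ∑ e ∈ E, y e * ω (g e) ∂(stdGaussianFamily ι) = 0 := by
  rw [integral_finsetSum _ fun e _ =>
    ((memLp_eval (g e)).const_mul (y e)).integrable one_le_two]
  simp [integral_const_mul, integral_eval]

lemma integral_linear_sq (E : Finset κ) {g : κ → ι} (hg : Function.Injective g) (y : κ → ℝ) :
    ∫ ω, (∑ e ∈ E, y e * ω (g e)) ^ 2 ∂(stdGaussianFamily ι) = ∑ e ∈ E, y e ^ 2 := by
  have h := covariance_linear (ι := ι) E hg y y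
  rw [covariance_self (Measurable.aemeasurable (by fun_prop)),
    variance_of_integral_eq_zero (Measurable.aemeasurable (by fun_prop))
    (integral_linear E g y)] at h
  simpa [sq] using h

lemma isGaussianProcess_eval :
    IsGaussianProcess (fun (i : ι) (ω : ι → ℝ) => ω i) (stdGaussianFamily ι) where
  hasGaussianLaw _ :=
    (iIndepFun_eval.precomp Subtype.val_injective).hasGaussianLaw fun i => hasGaussianLaw_eval i.1

/-- The characteristic function of a linear combination of independent standard Gaussians. -/
lemma integral_cexp_linear (E : Finset κ) {g : κ → ι} (hg : Function.Injective g) (y : κ → ℝ) :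
    ∫ ω, Complex.exp (((∑ e ∈ E, y e * ω (g e) : ℝ) : ℂ) * Complex.I) ∂(stdGaussianFamily ι) =
      Complex.exp ((-((∑ e ∈ E, y e ^ 2) / 2) : ℝ)) := by
  have hG : HasGaussianLaw (fun ω : ι → ℝ => ∑ e ∈ E, y e * ω (g e)) (stdGaussianFamily ι) :=
    (((isGaussianProcess_eval (ι := ι)).comp_right g).smul y).hasGaussianLaw_fun_sum (I := E)
  have h := hG.charFun_map_eq (1 : ℝ)
  rw [charFun_apply_real, integral_map (Measurable.aemeasurable (by fun_prop)) (by fun_prop)] at h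
  simp only [Complex.ofReal_one, one_mul, RCLike.inner_apply, map_one,
    mul_one] at h
  rw [h, integral_linear,
    variance_of_integral_eq_zero (Measurable.aemeasurable (by fun_prop)) (integral_linear E g y),
    integral_linear_sq E hg]
  push_cast
  ring_nf

lemma map_comp_injective {g : κ → ι} (hg : Function.Injective g) :
    (stdGaussianFamily ι).map (fun ω e => ω (g e)) = stdGaussianFamily κ :=
  Measure.map_infinitePi_infinitePi_of_inj (P := fun _ : ι => gaussianReal 0 1) hg

lemma measurable_piecewise (s : Set ι) [DecidablePred (· ∈ s)] :
    Measurable fun p : (ι → ℝ) × (ι → ℝ) => s.piecewise p.1 p.2 := by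
  refine measurable_pi_lambda _ fun i => ?_
  by_cases hi : i ∈ s <;> simp only [Set.piecewise, hi, if_true, if_false] <;> fun_prop

/-- Replacing some of the variables by independent copies does not change the law. -/
lemma map_piecewise (s : Set ι) [DecidablePred (· ∈ s)] :
    ((stdGaussianFamily ι).prod (stdGaussianFamily ι)).map
      (fun p => s.piecewise p.1 p.2) = stdGaussianFamily ι := by
  refine Measure.eq_infinitePi _ fun t A hA => ?_
  classical
  rw [Measure.map_apply (measurable_piecewise s)
    (MeasurableSet.pi t.countable_toSet fun i _ => hA i)]
  have : (fun p : (ι → ℝ) × (ι → ℝ) => s.piecewise p.1 p.2) ⁻¹' (Set.pi t A) =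
      (Set.pi (t.filter (· ∈ s)) A) ×ˢ (Set.pi (t.filter (· ∉ s)) A) := by
    ext p
    simp only [Set.mem_preimage, Set.mem_pi, Set.mem_prod, Finset.coe_filter, Set.mem_ofPred_eq,
      Set.piecewise, SetLike.mem_coe]
    constructor
    · intro h
      exact ⟨fun i hi => by simpa [hi.2] using h i hi.1, fun i hi => by simpa [hi.2] using h i hi.1⟩
    · rintro ⟨h1, h2⟩ i hi
      by_cases his : i ∈ s
      · simpa [his] using h1 i ⟨hi, his⟩
      · simpa [his] using h2 i ⟨hi, his⟩
  rw [this, Measure.prod_prod, stdGaussianFamily, Measure.infinitePi_pi _ fun i _ => hA i,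
    Measure.infinitePi_pi _ fun i _ => hA i, Finset.prod_filter_mul_prod_filter_not]

end Gaussian

/-! ### A conditional central limit theorem for bilinear forms. -/

section Bilinear

variable {ι X Y : Type*}

/-- The average of independent copies of a Gaussian quadratic form converges almost surely. -/
lemma ae_tendsto_average_quadratic (A : Finset X) (B : Finset Y) (h : X → Y → ℝ) :
    ∀ᵐ u ∂(stdGaussianFamily (X × ℕ)),
      Tendsto (fun N : ℕ => (∑ c ∈ Finset.range N, ∑ y ∈ B, (∑ x ∈ A, h x y * u (x, c)) ^ 2) / N)
        atTop (𝓝 (∑ y ∈ B, ∑ x ∈ A, h x y ^ 2)) := by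
  classical
  set μ := stdGaussianFamily (X × ℕ) with hμ
  let q : ℕ → (X × ℕ → ℝ) → ℝ := fun c u => ∑ y ∈ B, (∑ x ∈ A, h x y * u (x, c)) ^ 2
  have hqm : ∀ c, Measurable (q c) := fun c => by fun_prop
  have hint0 : ∀ y, Integrable (fun u : X × ℕ → ℝ => (∑ x ∈ A, h x y * u (x, 0)) ^ 2) μ :=
    fun y => (memLp_linear A (fun x => (x, 0)) fun x => h x y).integrable_sq
  have hint : Integrable (q 0) μ := integrable_finsetSum _ fun y _ => hint0 y
  have hmean : μ[q 0] = ∑ y ∈ B, ∑ x ∈ A, h x y ^ 2 := by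
    rw [integral_finsetSum _ fun y _ => hint0 y]
    exact Finset.sum_congr rfl fun y _ =>
      integral_linear_sq A (g := fun x : X => (x, 0)) (fun x x' hx => (Prod.ext_iff.1 hx).1) _
  -- The variable `q c` depends only on the coordinates in `A ×ˢ {c}`, and these blocks are
  -- disjoint. Pairwise independence suffices for the strong law.
  have hindep : Pairwise fun c c' => IndepFun (q c) (q c') μ := by
    intro c c' hcc
    have hd : Disjoint (A ×ˢ {c}) (A ×ˢ {c'}) := by
      rw [Finset.disjoint_product]
      exact Or.inr (by simpa using hcc)
    have := iIndepFun_eval.indepFun_finset (A ×ˢ {c}) (A ×ˢ {c'}) hd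
      fun i => measurable_pi_apply (X := fun _ : X × ℕ => ℝ) i
    let Q : (b : ℕ) → ((A ×ˢ {b} : Finset (X × ℕ)) → ℝ) → ℝ := fun b w =>
      ∑ y ∈ B, (∑ x : A, h x y * w ⟨(x, b), by simp⟩) ^ 2
    have hQ : ∀ b, Measurable (Q b) := fun b => by fun_prop
    have hq : ∀ b, q b = Q b ∘ fun u (i : (A ×ˢ {b} : Finset (X × ℕ))) => u i := by
      intro b
      ext u
      simp only [q, Q, Function.comp_apply]
      refine Finset.sum_congr rfl fun y _ => ?_
      rw [← Finset.sum_coe_sort A]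
    rw [hq c, hq c']
    exact this.comp (hQ c) (hQ c')
  have hident : ∀ c, IdentDistrib (q c) (q 0) μ μ := by
    intro c
    refine ⟨(hqm c).aemeasurable, (hqm 0).aemeasurable, ?_⟩
    -- Exchanging the copies `0` and `c` preserves the law and turns `q 0` into `q c`.
    let ρ : X × ℕ → X × ℕ := fun e => (e.1, Equiv.swap 0 c e.2)
    have hρ : Function.Injective ρ := fun e e' he => by
      have h1 := (Prod.ext_iff.1 he).1
      have h2 := (Equiv.swap 0 c).injective (Prod.ext_iff.1 he).2
      exact Prod.ext h1 h2
    have hm := map_comp_injective hρ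
    conv_rhs => rw [hμ, ← hm]
    rw [Measure.map_map (hqm 0) (by fun_prop)]
    congr 1
  have := strong_law_ae_real q hint hindep hident
  rw [hmean] at this
  exact this

/-- The conditional central limit theorem for bilinear forms in independent Gaussian families,
for characteristic functions. -/
lemma tendsto_integral_bilinear (A : Finset X) (B : Finset Y) (h : X → Y → ℝ)
    {g : X × ℕ → ι} (hg : Function.Injective g) {g' : Y × ℕ → ι} (hg' : Function.Injective g') :
    Tendsto (fun N : ℕ => ∫ u, ∫ v, Complex.exp ((((√(N : ℝ))⁻¹ * ∑ c ∈ Finset.range N,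
        ∑ x ∈ A, ∑ y ∈ B, h x y * u (g (x, c)) * v (g' (y, c)) : ℝ) : ℂ) * Complex.I)
        ∂(stdGaussianFamily ι) ∂(stdGaussianFamily ι)) atTop
      (𝓝 (Complex.exp ((-((∑ x ∈ A, ∑ y ∈ B, h x y ^ 2) / 2) : ℝ)))) := by
  let q : ℕ → (X × ℕ → ℝ) → ℝ := fun N u =>
    (∑ c ∈ Finset.range N, ∑ y ∈ B, (∑ x ∈ A, h x y * u (x, c)) ^ 2) / N
  have hqm : ∀ N, Measurable (q N) := fun c => by fun_prop
  -- For fixed `u` the form is linear in `v`, hence Gaussian, with conditional variance `q N`.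
  have hinner : ∀ (N : ℕ) (u : ι → ℝ), ∫ v, Complex.exp ((((√(N : ℝ))⁻¹ *
        ∑ c ∈ Finset.range N, ∑ x ∈ A, ∑ y ∈ B, h x y * u (g (x, c)) * v (g' (y, c)) : ℝ) : ℂ) *
        Complex.I) ∂(stdGaussianFamily ι) =
      Complex.exp ((-(q N (fun e => u (g e)) / 2) : ℝ)) := by
    intro N u
    have := integral_cexp_linear (ι := ι) (B ×ˢ Finset.range N) hg'
      (fun e => (√(N : ℝ))⁻¹ * ∑ x ∈ A, h x e.1 * u (g (x, e.2)))
    have e2 : ∑ e ∈ B ×ˢ Finset.range N,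
        ((√(N : ℝ))⁻¹ * ∑ x ∈ A, h x e.1 * u (g (x, e.2))) ^ 2 = q N (fun e => u (g e)) := by
      rw [Finset.sum_product_right]
      simp only [q, mul_pow, inv_pow, Real.sq_sqrt (Nat.cast_nonneg N), ← Finset.mul_sum]
      rw [div_eq_inv_mul]
    rw [e2] at this
    rw [← this]
    congr 1
    ext v
    congr 3
    rw [Finset.sum_product_right, Finset.mul_sum]
    refine Finset.sum_congr rfl fun c _ => ?_
    rw [Finset.sum_comm, Finset.mul_sum]
    refine Finset.sum_congr rfl fun y _ => ?_
    rw [mul_assoc, Finset.sum_mul]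
  simp_rw [hinner]
  have hmap : ∀ N : ℕ, ∫ u, Complex.exp ((-(q N (fun e => u (g e)) / 2) : ℝ))
        ∂(stdGaussianFamily ι) =
      ∫ u, Complex.exp ((-(q N u / 2) : ℝ)) ∂(stdGaussianFamily (X × ℕ)) := by
    intro N
    rw [← map_comp_injective hg, integral_map (Measurable.aemeasurable (by fun_prop))]
    exact Measurable.aestronglyMeasurable (by fun_prop)
  simp_rw [hmap]
  have hlim : ∫ _ : X × ℕ → ℝ, Complex.exp ((-((∑ x ∈ A, ∑ y ∈ B, h x y ^ 2) / 2) : ℝ))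
      ∂(stdGaussianFamily (X × ℕ)) =
      Complex.exp ((-((∑ x ∈ A, ∑ y ∈ B, h x y ^ 2) / 2) : ℝ)) := by simp
  rw [← hlim]
  refine tendsto_integral_of_dominated_convergence (fun _ => 1)
    (fun N => Measurable.aestronglyMeasurable (by fun_prop)) (integrable_const 1) ?_ ?_
  · refine fun N => ae_of_all _ fun u => ?_
    rw [← Complex.ofReal_exp, Complex.norm_real, Real.norm_eq_abs, abs_of_pos (Real.exp_pos _),
      Real.exp_le_one_iff, neg_nonpos]
    positivity
  · filter_upwards [ae_tendsto_average_quadratic A B h] with u hu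
    rw [Finset.sum_comm] at hu
    have := (Complex.continuous_ofReal.tendsto _).comp (hu.div_const 2).neg
    exact (Complex.continuous_exp.tendsto _).comp this

end Bilinear

/-! ### Periodic networks and the contraction of a bond. -/

/-- A periodic tensor network with bonds and sites in `Fin n`, evaluated on `m` inputs. The site
`i ∈ live` carries the bond on its left; the bond on its right is `next i`. The physical index of
site `i` runs over `phys i`, and `feat i k` is its feature vector on the input `k`. -/
structure Network (n m : ℕ) where
  live : Finset (Fin n)
  next : Fin n → Fin n
  phys : Fin n → Finset ℕ
  feat : Fin n → Fin m → ℕ → ℝ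

namespace Network

variable {n m : ℕ}

/-- The tensor at site `i`, contracted with the feature vector of the input `k`. -/
def tensor (M : Network n m) (ω : Fin n × ℕ × ℕ × ℕ → ℝ) (i : Fin n) (k : Fin m) (a b : ℕ) : ℝ :=
  ∑ t ∈ M.phys i, M.feat i k t * ω (i, t, a, b)

/-- The values of the bond indices. -/
def box (M : Network n m) (α : Fin n → ℕ) : Finset (Fin n → ℕ) :=
  -- A bond that is no longer live keeps the single value `0`, so configurations stay in `Fin n → ℕ`
  -- after a contraction.
  Fintype.piFinset fun i => Finset.range (if i ∈ M.live then α i else 1)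

/-- The normalized output of the network on the input `k`. -/
def value (M : Network n m) (α : Fin n → ℕ) (ω : Fin n × ℕ × ℕ × ℕ → ℝ) (k : Fin m) : ℝ :=
  (∏ i ∈ M.live, (√(α i : ℝ))⁻¹) *
    ∑ a ∈ M.box α, ∏ i ∈ M.live, M.tensor ω i k (a i) (a (M.next i))

lemma measurable_tensor (M : Network n m) (i : Fin n) (k : Fin m) (a b : ℕ) :
    Measurable fun ω => M.tensor ω i k a b := by
  unfold tensor
  fun_prop

lemma measurable_value (M : Network n m) (α : Fin n → ℕ) (k : Fin m) :
    Measurable fun ω => M.value α ω k := by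
  have := M.measurable_tensor
  unfold value
  fun_prop

/-- Contract the bond `j` between the sites `p` and `j`, which become the site `p`. -/
def merge (M : Network n m) (p j : Fin n) : Network n m where
  live := M.live.erase j
  next i := if M.next i = j then M.next j else M.next i
  -- Pairs of physical indices are coded by `Nat.pair`, so the contracted network reads the same
  -- source of randomness.
  phys := Function.update M.phys p ((M.phys p ×ˢ M.phys j).map Nat.pairEquiv.toEmbedding)
  feat := Function.update M.feat p fun k t =>
    M.feat p k (Nat.unpair t).1 * M.feat j k (Nat.unpair t).2

/-- The live sites form a single cycle. -/
structure IsCycle (M : Network n m) : Prop where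
  next_mem : ∀ i ∈ M.live, M.next i ∈ M.live
  injOn : Set.InjOn M.next M.live
  -- Excludes a permutation with several cycles; in particular a site that is its own neighbour is
  -- the only live site.
  eq_of_closed : ∀ T ⊆ M.live, T.Nonempty → (∀ i ∈ T, M.next i ∈ T) → T = M.live

/-- The contraction of all the tensors but those at the sites `p` and `j`, with prescribed values
of the bonds `p` and `M.next j`. -/
def environment (M : Network n m) (p j : Fin n) (α : Fin n → ℕ) (ω : Fin n × ℕ × ℕ × ℕ → ℝ)
    (k : Fin m) (a b : ℕ) : ℝ :=
  ∑ x ∈ (M.merge p j).box α, if x p = a ∧ x (M.next j) = b then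
    ∏ i ∈ (M.live.erase j).erase p, M.tensor ω i k (x i) (x (M.next i)) else 0

/-- Sorting the configurations by their values at `p` and `q` isolates the factor that sees these
two bonds only. The case `p = q` is allowed and needed: it occurs when two live sites are merged,
and then only the terms with `a = b` survive. -/
lemma sum_box_eq (M : Network n m) (α : Fin n → ℕ) {p q : Fin n} (hp : p ∈ M.live)
    (hq : q ∈ M.live) (F : ℕ → ℕ → ℝ) (G : (Fin n → ℕ) → ℝ) :
    ∑ x ∈ M.box α, F (x p) (x q) * G x =
      ∑ a ∈ Finset.range (α p), ∑ b ∈ Finset.range (α q),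
        F a b * ∑ x ∈ M.box α, if x p = a ∧ x q = b then G x else 0 := by
  simp_rw [Finset.mul_sum]
  have h1 : ∀ a ∈ Finset.range (α p),
      ∑ b ∈ Finset.range (α q), ∑ x ∈ M.box α, F a b * (if x p = a ∧ x q = b then G x else 0) =
      ∑ x ∈ M.box α, ∑ b ∈ Finset.range (α q), F a b * (if x p = a ∧ x q = b then G x else 0) :=
    fun a _ => Finset.sum_comm
  rw [Finset.sum_congr rfl h1, Finset.sum_comm]
  refine Finset.sum_congr rfl fun x hx => ?_
  have hxp : x p ∈ Finset.range (α p) := by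
    have := Fintype.mem_piFinset.1 hx p
    simpa [hp] using this
  have hxq : x q ∈ Finset.range (α q) := by
    have := Fintype.mem_piFinset.1 hx q
    simpa [hq] using this
  rw [Finset.sum_eq_single_of_mem _ hxp, Finset.sum_eq_single_of_mem _ hxq]
  · simp
  · intro b _ hb
    simp [hb.symm]
  · intro a _ ha
    simp [ha.symm]

section Merge

variable {M : Network n m} {p j : Fin n}

lemma IsCycle.next_ne (hM : M.IsCycle) (hp : p ∈ M.live) (hj : j ∈ M.live) (hpj : M.next p = j)
    (hne : p ≠ j) : M.next j ≠ j := fun h =>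
  hne (hM.injOn (Finset.mem_coe.2 hp) (Finset.mem_coe.2 hj) (hpj.trans h.symm))

lemma IsCycle.next_ne_of_ne (hM : M.IsCycle) (hp : p ∈ M.live) (hpj : M.next p = j) {i : Fin n}
    (hi : i ∈ M.live) (hip : i ≠ p) : M.next i ≠ j := fun h =>
  hip (hM.injOn (Finset.mem_coe.2 hi) (Finset.mem_coe.2 hp) (h.trans hpj.symm))

lemma IsCycle.merge (hM : M.IsCycle) (hp : p ∈ M.live) (hj : j ∈ M.live) (hpj : M.next p = j)
    (hne : p ≠ j) : (M.merge p j).IsCycle where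
  next_mem i hi := by
    have hi' := Finset.mem_erase.1 hi
    simp only [Network.merge]
    split_ifs with h
    · exact Finset.mem_erase.2 ⟨hM.next_ne hp hj hpj hne, hM.next_mem j hj⟩
    · exact Finset.mem_erase.2 ⟨h, hM.next_mem i hi'.2⟩
  injOn := by
    intro i hi i' hi' h
    have h1 := Finset.mem_erase.1 (Finset.mem_coe.1 hi)
    have h2 := Finset.mem_erase.1 (Finset.mem_coe.1 hi')
    have inj : ∀ {x y}, x ∈ M.live → y ∈ M.live → M.next x = M.next y → x = y :=
      fun hx hy hxy => hM.injOn (Finset.mem_coe.2 hx) (Finset.mem_coe.2 hy) hxy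
    simp only [Network.merge] at h
    split_ifs at h with c1 c2 c2
    · exact inj h1.2 h2.2 (c1.trans c2.symm)
    · exact absurd (inj hj h2.2 h).symm h2.1
    · exact absurd (inj h1.2 hj h) h1.1
    · exact inj h1.2 h2.2 h
  eq_of_closed T hT hT0 hcl := by
    have hTl : T ⊆ M.live := hT.trans (Finset.erase_subset _ _)
    have hjT : j ∉ T := fun h => (Finset.mem_erase.1 (hT h)).1 rfl
    -- If `p ∈ T`, putting `j` back gives a set closed in the original cycle. Otherwise `T` is
    -- already closed there, since only `p` points to `j`, and it would have to contain `j`.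
    by_cases hpT : p ∈ T
    · have h := hM.eq_of_closed (insert j T) (Finset.insert_subset hj hTl)
        (Finset.insert_nonempty _ _) ?_
      · simp only [Network.merge]
        rw [← h, Finset.erase_insert hjT]
      · intro i hi
        rcases Finset.mem_insert.1 hi with rfl | hi
        · have := hcl p hpT
          simp only [Network.merge, hpj, if_true] at this
          exact Finset.mem_insert_of_mem this
        · have := hcl i hi
          simp only [Network.merge] at this
          split_ifs at this with c
          · exact c ▸ Finset.mem_insert_self _ _
          · exact Finset.mem_insert_of_mem this
    · have h := hM.eq_of_closed T hTl hT0 fun i hi => by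
        have := hcl i hi
        have hn := hM.next_ne_of_ne hp hpj (hTl hi) (fun h => hpT (h ▸ hi))
        simpa only [Network.merge, hn, if_false] using this
      exact absurd (h ▸ hj) hjT

lemma tensor_merge (ω : Fin n × ℕ × ℕ × ℕ → ℝ) (k : Fin m) (a b : ℕ) :
    (M.merge p j).tensor ω p k a b = ∑ s ∈ M.phys p, ∑ t ∈ M.phys j,
      M.feat p k s * M.feat j k t * ω (p, Nat.pair s t, a, b) := by
  simp only [tensor, merge, Function.update_self]
  rw [Finset.sum_map, Finset.sum_product]
  simp

lemma tensor_merge_of_ne {i : Fin n} (hi : i ≠ p) (ω : Fin n × ℕ × ℕ × ℕ → ℝ) (k : Fin m)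
    (a b : ℕ) : (M.merge p j).tensor ω i k a b = M.tensor ω i k a b := by
  simp only [tensor, merge, Function.update_of_ne hi]

lemma value_merge (hM : M.IsCycle) (hp : p ∈ M.live) (hj : j ∈ M.live) (hpj : M.next p = j)
    (hne : p ≠ j) (α : Fin n → ℕ) (ω : Fin n × ℕ × ℕ × ℕ → ℝ) (k : Fin m) :
    (M.merge p j).value α ω k = (∏ i ∈ M.live.erase j, (√(α i : ℝ))⁻¹) *
      ∑ a ∈ Finset.range (α p), ∑ b ∈ Finset.range (α (M.next j)),
        (M.merge p j).tensor ω p k a b * M.environment p j α ω k a b := by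
  have hpl : p ∈ (M.merge p j).live := Finset.mem_erase.2 ⟨hne, hp⟩
  have hql : M.next j ∈ (M.merge p j).live :=
    Finset.mem_erase.2 ⟨hM.next_ne hp hj hpj hne, hM.next_mem j hj⟩
  unfold environment
  rw [← sum_box_eq (M.merge p j) α hpl hql]
  unfold value
  change (∏ i ∈ M.live.erase j, _) * _ = _
  congr 1
  refine Finset.sum_congr rfl fun x _ => ?_
  rw [← Finset.mul_prod_erase _ _ hpl]
  congr 1
  · simp [merge, hpj]
  · refine Finset.prod_congr rfl fun i hi => ?_
    have hi1 := Finset.mem_erase.1 hi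
    have hi2 := Finset.mem_erase.1 hi1.2
    rw [tensor_merge_of_ne hi1.1]
    simp [merge, hM.next_ne_of_ne hp hpj hi2.2 hi1.1]

/-- The box of the merged network is the slice where bond `j` has its default value `0`; the true
value `c` is summed separately. -/
lemma sum_box_update (hj : j ∈ M.live) (α : Fin n → ℕ) (N : ℕ) (F : (Fin n → ℕ) → ℝ) :
    ∑ x ∈ M.box (Function.update α j N), F x =
      ∑ c ∈ Finset.range N, ∑ x ∈ (M.merge p j).box α, F (Function.update x j c) := by
  rw [← Finset.sum_product']
  refine Finset.sum_bij' (fun x _ => (x j, Function.update x j 0))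
    (fun y _ => Function.update y.2 j y.1) ?_ ?_ ?_ ?_ ?_
  · intro x hx
    have hx := Fintype.mem_piFinset.1 hx
    refine Finset.mem_product.2 ⟨by simpa [hj] using hx j, Fintype.mem_piFinset.2 fun i => ?_⟩
    by_cases hi : i = j
    · subst hi
      simp [merge]
    · simpa [merge, hi] using hx i
  · intro y hy
    have hy1 := (Finset.mem_product.1 hy).1
    have hy2 := Fintype.mem_piFinset.1 (Finset.mem_product.1 hy).2
    refine Fintype.mem_piFinset.2 fun i => ?_
    by_cases hi : i = j
    · subst hi
      simpa [hj] using hy1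
    · simpa [merge, hi] using hy2 i
  · intro x _
    simp
  · intro y hy
    have hy2 := Fintype.mem_piFinset.1 (Finset.mem_product.1 hy).2 j
    have : y.2 j = 0 := by simpa [merge] using hy2
    ext1
    · simp
    · simp [← this]
  · intro x _
    simp

lemma value_update (hM : M.IsCycle) (hp : p ∈ M.live) (hj : j ∈ M.live) (hpj : M.next p = j)
    (hne : p ≠ j) (α : Fin n → ℕ) (N : ℕ) (ω : Fin n × ℕ × ℕ × ℕ → ℝ) (k : Fin m) :
    M.value (Function.update α j N) ω k =
      (√(N : ℝ))⁻¹ * (∏ i ∈ M.live.erase j, (√(α i : ℝ))⁻¹) *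
      ∑ c ∈ Finset.range N, ∑ a ∈ Finset.range (α p), ∑ b ∈ Finset.range (α (M.next j)),
        M.tensor ω p k a c * M.tensor ω j k c b * M.environment p j α ω k a b := by
  have hpl : p ∈ (M.merge p j).live := Finset.mem_erase.2 ⟨hne, hp⟩
  have hnj := hM.next_ne hp hj hpj hne
  have hql : M.next j ∈ (M.merge p j).live := Finset.mem_erase.2 ⟨hnj, hM.next_mem j hj⟩
  unfold value
  rw [← Finset.mul_prod_erase _ _ hj, sum_box_update (p := p) hj]
  congr 1
  · congr 1
    · simp
    · refine Finset.prod_congr rfl fun i hi => ?_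
      rw [Function.update_of_ne (Finset.ne_of_mem_erase hi)]
  · refine Finset.sum_congr rfl fun c _ => ?_
    unfold environment
    rw [← sum_box_eq (M.merge p j) α hpl hql (fun a b => M.tensor ω p k a c * M.tensor ω j k c b)]
    refine Finset.sum_congr rfl fun x _ => ?_
    rw [← Finset.mul_prod_erase _ _ hj,
      ← Finset.mul_prod_erase _ _ (Finset.mem_erase.2 ⟨hne, hp⟩ : p ∈ M.live.erase j), ← mul_assoc]
    congr 1
    · rw [hpj, Function.update_self, Function.update_of_ne hnj, Function.update_of_ne hne, mul_comm]
    · refine Finset.prod_congr rfl fun i hi => ?_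
      have hi1 := Finset.mem_erase.1 hi
      have hi2 := Finset.mem_erase.1 hi1.2
      rw [Function.update_of_ne hi2.1,
        Function.update_of_ne (hM.next_ne_of_ne hp hpj hi2.2 hi1.1)]

end Merge

end Network

/-! ### Conditioning by resampling some of the coordinates. -/

section Resample

variable {ι : Type*}

lemma measurable_integral_piecewise (s : Set ι) [DecidablePred (· ∈ s)] {F : (ι → ℝ) → ℂ}
    (hF : Measurable F) :
    Measurable fun ω => ∫ u, F (s.piecewise u ω) ∂(stdGaussianFamily ι) := by
  refine StronglyMeasurable.measurable (StronglyMeasurable.integral_prod_right'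
    (f := fun q : (ι → ℝ) × (ι → ℝ) => F (s.piecewise q.2 q.1)) ?_)
  exact ((hF.comp (measurable_piecewise s)).comp measurable_swap).stronglyMeasurable

/-- Fubini applied to `map_piecewise`. The inner integral is the conditional expectation given the
coordinates outside `s`. -/
lemma integral_piecewise (s : Set ι) [DecidablePred (· ∈ s)] {F : (ι → ℝ) → ℂ}
    (hF : Measurable F) (hF1 : ∀ ω, ‖F ω‖ ≤ 1) :
    ∫ ω, F ω ∂(stdGaussianFamily ι) =
      ∫ ω, ∫ u, F (s.piecewise u ω) ∂(stdGaussianFamily ι) ∂(stdGaussianFamily ι) := by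
  conv_lhs => rw [← map_piecewise s]
  rw [integral_map (measurable_piecewise s).aemeasurable hF.aestronglyMeasurable,
    integral_prod_symm]
  exact Integrable.of_bound (hF.comp (measurable_piecewise s)).aestronglyMeasurable 1
    (ae_of_all _ fun _ => hF1 _)

lemma norm_cexp_mul_I_le (x : ℝ) : ‖Complex.exp (x * Complex.I)‖ ≤ 1 :=
  (Complex.norm_exp_ofReal_mul_I x).le

lemma norm_integral_le_one {F : (ι → ℝ) → ℂ} (hF1 : ∀ ω, ‖F ω‖ ≤ 1) :
    ‖∫ ω, F ω ∂(stdGaussianFamily ι)‖ ≤ 1 := by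
  have := norm_integral_le_of_norm_le_const (μ := stdGaussianFamily ι) (ae_of_all _ hF1)
  simpa using this

lemma integral_piecewise_piecewise (s t : Set ι) [DecidablePred (· ∈ s)] [DecidablePred (· ∈ t)]
    {F : (ι → ℝ) → ℂ} (hF : Measurable F) (hF1 : ∀ ω, ‖F ω‖ ≤ 1) :
    ∫ ω, F ω ∂(stdGaussianFamily ι) =
      ∫ ω, ∫ u, ∫ v, F (t.piecewise v (s.piecewise u ω))
        ∂(stdGaussianFamily ι) ∂(stdGaussianFamily ι) ∂(stdGaussianFamily ι) := by
  rw [integral_piecewise t hF hF1, integral_piecewise s]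
  · exact measurable_integral_piecewise t hF
  · exact fun ω => norm_integral_le_one fun _ => hF1 _

end Resample

lemma sum_range_phys {P Q : Finset ℕ} {I J : Finset ℕ} (H : ℕ → ℕ → ℕ → ℕ → ℝ) :
    ∑ a ∈ I, ∑ b ∈ J, ∑ s ∈ P, ∑ t ∈ Q, H s a t b =
      ∑ x ∈ P ×ˢ I, ∑ y ∈ Q ×ˢ J, H x.1 x.2 y.1 y.2 := by
  rw [Finset.sum_product_right]
  refine Finset.sum_congr rfl fun a _ => ?_
  rw [Finset.sum_comm]
  refine Finset.sum_congr rfl fun s _ => ?_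
  rw [Finset.sum_product_right]

/-! ### The limit in one bond dimension. -/

namespace Network

variable {n m : ℕ} {M : Network n m} {p j : Fin n}

/-- The coordinates of the source of randomness that belong to the site `i`. -/
def siteSet (i : Fin n) : Set (Fin n × ℕ × ℕ × ℕ) := {e | e.1 = i}

instance (i : Fin n) : DecidablePred (· ∈ siteSet i) := fun e => decEq e.1 i

lemma tensor_congr {ω ω' : Fin n × ℕ × ℕ × ℕ → ℝ} {i : Fin n}
    (h : ∀ e, ω (i, e) = ω' (i, e)) (k : Fin m) (a b : ℕ) :
    M.tensor ω i k a b = M.tensor ω' i k a b := by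
  simp only [tensor, h]

lemma tensor_piecewise_self (u ω : Fin n × ℕ × ℕ × ℕ → ℝ) (i : Fin n) (k : Fin m) (a b : ℕ) :
    M.tensor ((siteSet i).piecewise u ω) i k a b = M.tensor u i k a b :=
  tensor_congr (fun e => Set.piecewise_eq_of_mem _ _ _ (by simp [siteSet])) k a b

lemma tensor_piecewise_of_ne (u ω : Fin n × ℕ × ℕ × ℕ → ℝ) {i i' : Fin n} (h : i ≠ i')
    (k : Fin m) (a b : ℕ) :
    M.tensor ((siteSet i').piecewise u ω) i k a b = M.tensor ω i k a b :=
  tensor_congr (fun e => Set.piecewise_eq_of_notMem _ _ _ (by simp [siteSet, h])) k a b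

lemma environment_congr {α : Fin n → ℕ} {ω ω' : Fin n × ℕ × ℕ × ℕ → ℝ}
    (h : ∀ i, i ≠ p → i ≠ j → ∀ e, ω (i, e) = ω' (i, e)) (k : Fin m) (a b : ℕ) :
    M.environment p j α ω k a b = M.environment p j α ω' k a b := by
  unfold environment
  refine Finset.sum_congr rfl fun x _ => ?_
  congr 1
  refine Finset.prod_congr rfl fun i hi => ?_
  have hi1 := Finset.mem_erase.1 hi
  exact tensor_congr (h i hi1.1 (Finset.ne_of_mem_erase hi1.2)) _ _ _

lemma environment_piecewise_left {α : Fin n → ℕ} (u ω : Fin n × ℕ × ℕ × ℕ → ℝ) (k : Fin m)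
    (a b : ℕ) : M.environment p j α ((siteSet p).piecewise u ω) k a b =
      M.environment p j α ω k a b :=
  environment_congr (fun _ hip _ _ => Set.piecewise_eq_of_notMem _ _ _
    (by simpa [siteSet] using hip)) k a b

lemma environment_piecewise_right {α : Fin n → ℕ} (u ω : Fin n × ℕ × ℕ × ℕ → ℝ) (k : Fin m)
    (a b : ℕ) : M.environment p j α ((siteSet j).piecewise u ω) k a b =
      M.environment p j α ω k a b :=
  environment_congr (fun _ _ hij _ => Set.piecewise_eq_of_notMem _ _ _
    (by simpa [siteSet] using hij)) k a b

/-- The coefficients of the output as a bilinear form in the tensors at the sites `p` and `j`,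
given all the other tensors. -/
def coupling (M : Network n m) (p j : Fin n) (α : Fin n → ℕ) (t : Fin m → ℝ)
    (ω : Fin n × ℕ × ℕ × ℕ → ℝ) (x y : ℕ × ℕ) : ℝ :=
  ∑ k, t k * ((∏ i ∈ M.live.erase j, (√(α i : ℝ))⁻¹) *
    (M.feat p k x.1 * M.feat j k y.1 * M.environment p j α ω k x.2 y.2))

lemma sum_value_merge (hM : M.IsCycle) (hp : p ∈ M.live) (hj : j ∈ M.live) (hpj : M.next p = j)
    (hne : p ≠ j) (α : Fin n → ℕ) (t : Fin m → ℝ) (w ω : Fin n × ℕ × ℕ × ℕ → ℝ) :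
    ∑ k, t k * (M.merge p j).value α ((siteSet p).piecewise w ω) k =
      ∑ e ∈ (M.phys p ×ˢ Finset.range (α p)) ×ˢ (M.phys j ×ˢ Finset.range (α (M.next j))),
        M.coupling p j α t ω e.1 e.2 * w (p, Nat.pair e.1.1 e.2.1, e.1.2, e.2.2) := by
  simp_rw [value_merge hM hp hj hpj hne, environment_piecewise_left, tensor_piecewise_self,
    tensor_merge, Finset.sum_mul, coupling]
  rw [Finset.sum_product]
  simp_rw [sum_range_phys (fun s a t b => M.feat p _ s * M.feat j _ t *
    w (p, Nat.pair s t, a, b) * M.environment p j α ω _ a b), Finset.mul_sum, Finset.sum_mul]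
  rw [Finset.sum_comm]
  refine Finset.sum_congr rfl fun x _ => ?_
  rw [Finset.sum_comm]
  refine Finset.sum_congr rfl fun y _ => Finset.sum_congr rfl fun k _ => ?_
  ring

lemma sum_value_update (hM : M.IsCycle) (hp : p ∈ M.live) (hj : j ∈ M.live)
    (hpj : M.next p = j) (hne : p ≠ j) (α : Fin n → ℕ) (N : ℕ) (t : Fin m → ℝ)
    (u v ω : Fin n × ℕ × ℕ × ℕ → ℝ) :
    ∑ k, t k * M.value (Function.update α j N)
        ((siteSet j).piecewise v ((siteSet p).piecewise u ω)) k =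
      (√(N : ℝ))⁻¹ * ∑ c ∈ Finset.range N, ∑ x ∈ M.phys p ×ˢ Finset.range (α p),
        ∑ y ∈ M.phys j ×ˢ Finset.range (α (M.next j)),
          M.coupling p j α t ω x y * u (p, x.1, x.2, c) * v (j, y.1, c, y.2) := by
  have hexp : ∀ k c, ∑ a ∈ Finset.range (α p), ∑ b ∈ Finset.range (α (M.next j)),
      M.tensor u p k a c * M.tensor v j k c b * M.environment p j α ω k a b =
      ∑ x ∈ M.phys p ×ˢ Finset.range (α p), ∑ y ∈ M.phys j ×ˢ Finset.range (α (M.next j)),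
        M.feat p k x.1 * u (p, x.1, x.2, c) * (M.feat j k y.1 * v (j, y.1, c, y.2)) *
          M.environment p j α ω k x.2 y.2 := by
    intro k c
    rw [← sum_range_phys (fun s a t b => M.feat p k s * u (p, s, a, c) *
      (M.feat j k t * v (j, t, c, b)) * M.environment p j α ω k a b)]
    refine Finset.sum_congr rfl fun a _ => Finset.sum_congr rfl fun b _ => ?_
    simp_rw [tensor, Finset.sum_mul_sum, Finset.sum_mul]
  simp_rw [value_update hM hp hj hpj hne, environment_piecewise_right, environment_piecewise_left,
    tensor_piecewise_self, tensor_piecewise_of_ne _ _ hne, tensor_piecewise_self, hexp, coupling,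
    Finset.mul_sum, Finset.sum_mul, Finset.mul_sum]
  rw [Finset.sum_comm]
  refine Finset.sum_congr rfl fun c _ => ?_
  rw [Finset.sum_comm]
  refine Finset.sum_congr rfl fun x _ => ?_
  rw [Finset.sum_comm]
  refine Finset.sum_congr rfl fun y _ => Finset.sum_congr rfl fun k _ => ?_
  ring

lemma measurable_sum_value (M : Network n m) (α : Fin n → ℕ) (t : Fin m → ℝ) :
    Measurable fun ω => ∑ k, t k * M.value α ω k := by
  have := M.measurable_value α
  fun_prop

lemma measurable_cexp_value (M : Network n m) (α : Fin n → ℕ) (t : Fin m → ℝ) :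
    Measurable fun ω =>
      Complex.exp (((∑ k, t k * M.value α ω k : ℝ) : ℂ) * Complex.I) := by
  have := M.measurable_sum_value α t
  fun_prop

/-- Convergence of the characteristic function of the output as one bond dimension goes to
infinity. -/
theorem tendsto_integral_cexp_value (hM : M.IsCycle) (hp : p ∈ M.live) (hj : j ∈ M.live)
    (hpj : M.next p = j) (hne : p ≠ j) (α : Fin n → ℕ) (t : Fin m → ℝ) :
    Tendsto (fun N : ℕ => ∫ ω, Complex.exp (((∑ k, t k *
        M.value (Function.update α j N) ω k : ℝ) : ℂ) * Complex.I) ∂(stdGaussianFamily _)) atTop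
      (𝓝 (∫ ω, Complex.exp (((∑ k, t k * (M.merge p j).value α ω k : ℝ) : ℂ) * Complex.I)
        ∂(stdGaussianFamily _))) := by
  -- In the merged network only the tensor at `p` is resampled. The environment involves neither `p`
  -- nor `j`, so both sides become integrals over the same frozen `ω`, and it is enough to compare
  -- the inner integrals.
  have hlim := integral_piecewise (siteSet p) ((M.merge p j).measurable_cexp_value α t)
    fun ω => norm_cexp_mul_I_le _
  rw [hlim]
  simp_rw [sum_value_merge hM hp hj hpj hne]
  -- `Nat.pair` is injective, so distinct entries of the merged tensor are distinct coordinates and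
  -- hence independent.
  have hg0 : Function.Injective fun e : (ℕ × ℕ) × (ℕ × ℕ) =>
      (p, Nat.pair e.1.1 e.2.1, e.1.2, e.2.2) := by
    rintro ⟨⟨s, a⟩, t, b⟩ ⟨⟨s', a'⟩, t', b'⟩ h
    simp only [Prod.mk.injEq, Nat.pair_eq_pair, true_and] at h ⊢
    tauto
  simp_rw [integral_cexp_linear _ hg0, Finset.sum_product _ _ (fun e : (ℕ × ℕ) × (ℕ × ℕ) =>
    M.coupling p j α t _ e.1 e.2 ^ 2)]
  have hg : Function.Injective fun e : (ℕ × ℕ) × ℕ => (p, e.1.1, e.1.2, e.2) := by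
    rintro ⟨⟨s, a⟩, c⟩ ⟨⟨s', a'⟩, c'⟩ h
    simp only [Prod.mk.injEq, true_and] at h ⊢
    tauto
  have hg' : Function.Injective fun e : (ℕ × ℕ) × ℕ => (j, e.1.1, e.2, e.1.2) := by
    rintro ⟨⟨s, a⟩, c⟩ ⟨⟨s', a'⟩, c'⟩ h
    simp only [Prod.mk.injEq, true_and] at h ⊢
    tauto
  -- Before the limit the tensors at `p` and `j` are resampled independently, which produces the
  -- bilinear form in `u` and `v`.
  have hN := fun N : ℕ => integral_piecewise_piecewise (siteSet p) (siteSet j)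
    (M.measurable_cexp_value (Function.update α j N) t) fun ω => norm_cexp_mul_I_le _
  simp_rw [hN]
  refine tendsto_integral_of_dominated_convergence (fun _ => 1) (fun N => ?_)
    (integrable_const 1) (fun N => ae_of_all _ fun ω => ?_) (ae_of_all _ fun ω => ?_)
  · exact (measurable_integral_piecewise (siteSet p) (measurable_integral_piecewise (siteSet j)
      (M.measurable_cexp_value (Function.update α j N) t))).aestronglyMeasurable
  · exact norm_integral_le_one fun u => norm_integral_le_one fun v => norm_cexp_mul_I_le _
  · have h := tendsto_integral_bilinear (M.phys p ×ˢ Finset.range (α p))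
      (M.phys j ×ˢ Finset.range (α (M.next j))) (M.coupling p j α t ω) hg hg'
    refine h.congr fun N => integral_congr_ae (ae_of_all _ fun u =>
      integral_congr_ae (ae_of_all _ fun v => ?_))
    dsimp only
    rw [sum_value_update hM hp hj hpj hne]

end Network

/-- Lévy's convergence theorem on `Fin m → ℝ`. -/
lemma tendsto_of_tendsto_integral_cexp {m : ℕ} {μ : ℕ → ProbabilityMeasure (Fin m → ℝ)}
    {ν : ProbabilityMeasure (Fin m → ℝ)}
    (h : ∀ t : Fin m → ℝ, Tendsto
      (fun N => ∫ x : Fin m → ℝ, Complex.exp (((∑ k, t k * x k : ℝ) : ℂ) * Complex.I)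
        ∂(μ N : Measure (Fin m → ℝ))) atTop
      (𝓝 (∫ x : Fin m → ℝ, Complex.exp (((∑ k, t k * x k : ℝ) : ℂ) * Complex.I)
          ∂(ν : Measure (Fin m → ℝ))))) :
    Tendsto μ atTop (𝓝 ν) := by
  -- Characteristic functions need an inner product, so the laws are carried to `EuclideanSpace ℝ
  -- (Fin m)` and back.
  have hto : Continuous (WithLp.toLp 2 : (Fin m → ℝ) → EuclideanSpace ℝ (Fin m)) :=
    PiLp.continuous_toLp 2 _
  have hof : Continuous (WithLp.ofLp : EuclideanSpace ℝ (Fin m) → Fin m → ℝ) :=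
    PiLp.continuous_ofLp 2 _
  have hchar : ∀ (ρ : ProbabilityMeasure (Fin m → ℝ)) (t : EuclideanSpace ℝ (Fin m)),
      charFun (ρ.map hto.measurable.aemeasurable : Measure (EuclideanSpace ℝ (Fin m))) t =
        ∫ x : Fin m → ℝ, Complex.exp (((∑ k, t k * x k : ℝ) : ℂ) * Complex.I)
          ∂(ρ : Measure (Fin m → ℝ)) := by
    intro ρ t
    rw [charFun_apply, ProbabilityMeasure.toMeasure_map, integral_map hto.measurable.aemeasurable
      (by fun_prop)]
    simp only [PiLp.inner_apply, RCLike.inner_apply, conj_trivial]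
  have hE : Tendsto (fun N => (μ N).map hto.measurable.aemeasurable) atTop
      (𝓝 (ν.map hto.measurable.aemeasurable)) := by
    refine ProbabilityMeasure.tendsto_of_tendsto_charFun fun t => ?_
    simp_rw [hchar]
    exact h t
  have hback : ∀ ρ : ProbabilityMeasure (Fin m → ℝ),
      (ρ.map hto.measurable.aemeasurable).map hof.measurable.aemeasurable = ρ := by
    intro ρ
    apply Subtype.ext
    change Measure.map _ (Measure.map _ (ρ : Measure (Fin m → ℝ))) = _
    rw [Measure.map_map hof.measurable hto.measurable]
    exact Measure.map_id
  have := ProbabilityMeasure.tendsto_map_of_tendsto_of_continuous _ _ hE hof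
  simpa only [hback] using this

/-! ### Iterating the limits down to a single site. -/

namespace Network

variable {n m : ℕ}

/-- The joint law of the outputs of the network. -/
def law (M : Network n m) (α : Fin n → ℕ) : ProbabilityMeasure (Fin m → ℝ) :=
  ⟨(stdGaussianFamily (Fin n × ℕ × ℕ × ℕ)).map (M.value α),
    Measure.isProbabilityMeasure_map
      (measurable_pi_lambda _ (M.measurable_value α)).aemeasurable⟩

lemma integral_cexp_law (M : Network n m) (α : Fin n → ℕ) (t : Fin m → ℝ) :
    ∫ x : Fin m → ℝ, Complex.exp (((∑ k, t k * x k : ℝ) : ℂ) * Complex.I)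
          ∂(M.law α : Measure (Fin m → ℝ)) =
      ∫ ω, Complex.exp (((∑ k, t k * M.value α ω k : ℝ) : ℂ) * Complex.I)
        ∂(stdGaussianFamily _) := by
  exact integral_map (measurable_pi_lambda _ (M.measurable_value α)).aemeasurable
    (Measurable.aestronglyMeasurable (by fun_prop))

theorem tendsto_law {M : Network n m} {p j : Fin n} (hM : M.IsCycle) (hp : p ∈ M.live)
    (hj : j ∈ M.live) (hpj : M.next p = j) (hne : p ≠ j) (α : Fin n → ℕ) :
    Tendsto (fun N : ℕ => M.law (Function.update α j N)) atTop (𝓝 ((M.merge p j).law α)) := by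
  refine tendsto_of_tendsto_integral_cexp fun t => ?_
  simp_rw [integral_cexp_law]
  exact tendsto_integral_cexp_value hM hp hj hpj hne α t

/-- The inner product of the feature vectors of two inputs at the site `i`. -/
def gram (M : Network n m) (i : Fin n) (k k' : Fin m) : ℝ :=
  ∑ t ∈ M.phys i, M.feat i k t * M.feat i k' t

/-- The inner product of two tensor products is the product of the inner products; the other sites
are unchanged. -/
lemma prod_gram_merge {M : Network n m} {p j : Fin n} (hp : p ∈ M.live) (hj : j ∈ M.live)
    (hne : p ≠ j) (k k' : Fin m) :
    ∏ i ∈ (M.merge p j).live, (M.merge p j).gram i k k' = ∏ i ∈ M.live, M.gram i k k' := by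
  have hpl : p ∈ M.live.erase j := Finset.mem_erase.2 ⟨hne, hp⟩
  change ∏ i ∈ M.live.erase j, _ = _
  rw [← Finset.mul_prod_erase _ _ hj, ← Finset.mul_prod_erase _ _ hpl,
    ← Finset.mul_prod_erase _ _ hpl, ← mul_assoc]
  congr 1
  · simp only [gram, merge, Function.update_self]
    rw [mul_comm, Finset.sum_mul_sum, Finset.sum_map, Finset.sum_product]
    refine Finset.sum_congr rfl fun s _ => Finset.sum_congr rfl fun t _ => ?_
    simp only [Equiv.coe_toEmbedding, Nat.pairEquiv_apply, Function.uncurry_apply_pair,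
      Nat.unpair_pair]
    ring
  · refine Finset.prod_congr rfl fun i hi => ?_
    simp only [gram, merge, Function.update_of_ne (Finset.ne_of_mem_erase hi)]

lemma value_of_live_eq_singleton {M : Network n m} {j : Fin n} (hlive : M.live = {j})
    (hnext : M.next j = j) (α : Fin n → ℕ) (ω : Fin n × ℕ × ℕ × ℕ → ℝ) (k : Fin m) :
    M.value α ω k = (√(α j : ℝ))⁻¹ * ∑ a ∈ Finset.range (α j), M.tensor ω j k a a := by
  unfold value
  simp only [hlive, Finset.prod_singleton, hnext]
  congr 1
  refine Finset.sum_bij' (fun x _ => x j) (fun a _ => Function.update 0 j a) ?_ ?_ ?_ ?_ ?_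
  · intro x hx
    simpa [hlive] using Fintype.mem_piFinset.1 hx j
  · intro a ha
    refine Fintype.mem_piFinset.2 fun i => ?_
    by_cases hi : i = j
    · subst hi
      simpa [hlive] using ha
    · simp [hlive, hi]
  · intro x hx
    ext i
    by_cases hi : i = j
    · subst hi
      simp
    · have := Fintype.mem_piFinset.1 hx i
      simp only [hlive, Finset.mem_singleton, hi, if_false, Finset.mem_range, Nat.lt_one_iff]
        at this
      simp [hi, this]
  · intro a _
    simp
  · intro x _
    rfl

lemma integral_cexp_value_of_live_eq_singleton {M : Network n m} {j : Fin n}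
    (hlive : M.live = {j}) (hnext : M.next j = j) {α : Fin n → ℕ} (hα : 0 < α j)
    (t : Fin m → ℝ) :
    ∫ ω, Complex.exp (((∑ k, t k * M.value α ω k : ℝ) : ℂ) * Complex.I) ∂(stdGaussianFamily _) =
      Complex.exp ((-((∑ k, ∑ k', t k * t k' * M.gram j k k') / 2) : ℝ)) := by
  have hg : Function.Injective fun e : ℕ × ℕ => (j, e.1, e.2, e.2) := by
    rintro ⟨s, a⟩ ⟨s', a'⟩ h
    simp only [Prod.mk.injEq, true_and] at h ⊢
    tauto
  have hlin : ∀ ω, ∑ k, t k * M.value α ω k = ∑ e ∈ M.phys j ×ˢ Finset.range (α j),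
      ((√(α j : ℝ))⁻¹ * ∑ k, t k * M.feat j k e.1) * ω (j, e.1, e.2, e.2) := by
    intro ω
    simp_rw [value_of_live_eq_singleton hlive hnext, tensor, Finset.mul_sum, Finset.sum_mul]
    rw [Finset.sum_product_right, Finset.sum_comm]
    refine Finset.sum_congr rfl fun a _ => ?_
    rw [Finset.sum_comm]
    refine Finset.sum_congr rfl fun s _ => Finset.sum_congr rfl fun k _ => ?_
    ring
  simp_rw [hlin, integral_cexp_linear _ hg]
  congr 4
  rw [Finset.sum_product_right]
  simp only [mul_pow, inv_pow, Real.sq_sqrt (Nat.cast_nonneg _), Finset.sum_const,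
    Finset.card_range, nsmul_eq_mul, ← Finset.mul_sum]
  rw [mul_inv_cancel_left₀ (by positivity)]
  simp_rw [sq, Finset.sum_mul_sum, gram, Finset.mul_sum]
  rw [Finset.sum_comm]
  refine Finset.sum_congr rfl fun k _ => ?_
  rw [Finset.sum_comm]
  refine Finset.sum_congr rfl fun k' _ => Finset.sum_congr rfl fun s _ => ?_
  ring

/-- The iterated limit of the laws of a cyclic network is the Gaussian law whose covariance is
the product over the sites of the Gram matrices of the features. -/
theorem seqTendsto_law [NeZero n] {C : Fin m → Fin m → ℝ} {L : ProbabilityMeasure (Fin m → ℝ)}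
    (hL : ∀ t : Fin m → ℝ,
      ∫ x : Fin m → ℝ, Complex.exp (((∑ k, t k * x k : ℝ) : ℂ) * Complex.I)
          ∂(L : Measure (Fin m → ℝ)) =
        Complex.exp ((-((∑ k, ∑ k', t k * t k' * C k k') / 2) : ℝ))) :
    ∀ (l : List (Fin n)) (M : Network n m), l ≠ [] → l.Nodup → l.toFinset = M.live → M.IsCycle →
      (∀ k k', ∏ i ∈ M.live, M.gram i k k' = C k k') → SeqTendsto l M.law L
  | [], _, h0, _, _, _, _ => absurd rfl h0
  | [j], M, _, _, hlive, hM, hC => by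
    have hlive : M.live = {j} := by simpa using hlive.symm
    have hnext : M.next j = j := by
      have := hM.next_mem j (by simp [hlive])
      simpa [hlive] using this
    refine ⟨fun _ => L, fun α _ => ?_, fun _ _ => rfl⟩
    refine tendsto_of_tendsto_integral_cexp fun t => ?_
    -- With one live site the law equals `L` for every `N > 0`, so the sequence is eventually
    -- constant.
    refine tendsto_const_nhds.congr' ?_
    filter_upwards [eventually_gt_atTop 0] with N hN
    rw [integral_cexp_law, integral_cexp_value_of_live_eq_singleton hlive hnext (by simpa), hL]
    simp_rw [← hC, hlive, Finset.prod_singleton]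
  | j :: j' :: l, M, _, hl, hlive, hM, hC => by
    have hj : j ∈ M.live := by simp [← hlive]
    have hj' : j' ∈ M.live := by simp [← hlive]
    obtain ⟨p, hp, hpj⟩ : ∃ p ∈ M.live, M.next p = j :=
      Finset.surjOn_of_injOn_of_card_le M.next hM.next_mem hM.injOn le_rfl hj
    -- A loop at `p` would make `{p}` the whole cycle, but `j'` is a second live site.
    have hne : p ≠ j := by
      rintro rfl
      have := hM.eq_of_closed {p} (by simpa using hp) (Finset.singleton_nonempty p)
        (by simpa using hpj)
      rw [← this, Finset.mem_singleton] at hj'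
      simp [hj'] at hl
    refine ⟨(M.merge p j).law, fun α _ => tendsto_law hM hp hj hpj hne α, ?_⟩
    refine seqTendsto_law hL (j' :: l) (M.merge p j) (by simp) hl.of_cons ?_
      (hM.merge hp hj hpj hne) fun k k' => by rw [prod_gram_merge hp hj hne, hC]
    change _ = M.live.erase j
    rw [← hlive, List.toFinset_cons (a := j),
      Finset.erase_insert (by simpa using (List.nodup_cons.1 hl).1)]

end Network

lemma sum_fin_eq_sum_piFinset {n : ℕ} (α : Fin n → ℕ) (F : (Fin n → ℕ) → ℝ) :
    ∑ a : (∀ i, Fin (α i)), F (fun i => a i) =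
      ∑ a ∈ Fintype.piFinset fun i => Finset.range (α i), F a := by
  refine Finset.sum_bij' (fun a _ i => (a i : ℕ))
    (fun a ha i => ⟨a i, Finset.mem_range.1 (Fintype.mem_piFinset.1 ha i)⟩) ?_ ?_ ?_ ?_ ?_
  · intro a _
    exact Fintype.mem_piFinset.2 fun i => Finset.mem_range.2 (a i).2
  all_goals simp

/-! ### The matrix product state as a cyclic network. -/

section MatrixProductState

variable {n : ℕ} [NeZero n] {X : Fin n → Type*} {d : Fin n → ℕ} {m : ℕ}

/-- The matrix product state as a tensor network. -/
def matrixProductState (φ : ∀ i, X i → Fin (d i) → ℝ) (σ : Fin n → ℝ) (x : Fin m → ∀ i, X i) :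
    Network n m where
  live := Finset.univ
  next i := i + 1
  phys i := Finset.range (d i)
  -- The factor `σ i` is moved from the tensor into the feature vector. The value `0` outside the
  -- physical range is never read.
  feat i k t := if h : t < d i then σ i * φ i (x k i) ⟨t, h⟩ else 0

lemma eq_univ_of_add_one_mem {T : Finset (Fin n)} (hT : T.Nonempty)
    (h : ∀ i ∈ T, i + 1 ∈ T) : T = Finset.univ := by
  obtain ⟨i, hi⟩ := hT
  have key : ∀ v (hv : v < n), i + ⟨v, hv⟩ ∈ T := by
    intro v
    induction v with
    | zero =>
      intro hv
      have : (⟨0, hv⟩ : Fin n) = 0 := Fin.ext (by simp)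
      simpa [this] using hi
    | succ v ih =>
      intro hv
      have := h _ (ih (by omega))
      rw [add_assoc] at this
      convert! this using 2
      refine Fin.ext ?_
      rw [Fin.val_add, Fin.val_one']
      simp only [Nat.add_mod_mod]
      rw [Nat.mod_eq_of_lt hv]
  refine Finset.eq_univ_of_forall fun y => ?_
  simpa using key (y - i).1 (y - i).2

lemma isCycle_matrixProductState (φ : ∀ i, X i → Fin (d i) → ℝ) (σ : Fin n → ℝ)
    (x : Fin m → ∀ i, X i) : (matrixProductState φ σ x).IsCycle where
  next_mem _ _ := Finset.mem_univ _
  injOn _ _ _ _ h := add_right_cancel (a := _) (b := (1 : Fin n)) h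
  eq_of_closed _ _ hT h := eq_univ_of_add_one_mem hT h

lemma prod_gram_matrixProductState (φ : ∀ i, X i → Fin (d i) → ℝ) (σ : Fin n → ℝ)
    (x : Fin m → ∀ i, X i) (k k' : Fin m) :
    ∏ i ∈ (matrixProductState φ σ x).live, (matrixProductState φ σ x).gram i k k' =
      limitCov φ σ (x k) (x k') := by
  refine Finset.prod_congr rfl fun i _ => ?_
  simp only [Network.gram, matrixProductState, dotProduct]
  rw [Finset.sum_range, Finset.mul_sum]
  refine Finset.sum_congr rfl fun s _ => ?_
  simp only [s.2, dif_pos]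
  ring

/-- The standard deviation of an entry of the tensor at site `i` is `entryScale α i * σ i`. -/
def entryScale (α : Fin n → ℕ) (i : Fin n) : ℝ :=
  (√(√((α i : ℝ) * (α (i + 1) : ℝ))))⁻¹

/-- Each factor splits into fourth roots of the two adjacent bond dimensions. A cyclic shift pairs
the two fourth roots belonging to the same bond. -/
lemma prod_entryScale (α : Fin n → ℕ) :
    ∏ i, entryScale α i = ∏ i, (√(α i : ℝ))⁻¹ := by
  have h : ∀ i, entryScale α i = (√√(α i : ℝ))⁻¹ * (√√(α (i + 1) : ℝ))⁻¹ := fun i => by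
    rw [entryScale, Real.sqrt_mul (Nat.cast_nonneg _), Real.sqrt_mul (Real.sqrt_nonneg _), mul_inv]
  simp_rw [h]
  have hshift := Equiv.prod_comp (Equiv.addRight (1 : Fin n)) fun i => (√√(α i : ℝ))⁻¹
  simp only [Equiv.coe_addRight] at hshift
  rw [Finset.prod_mul_distrib, hshift, ← Finset.prod_mul_distrib]
  refine Finset.prod_congr rfl fun i _ => ?_
  rw [← mul_inv, Real.mul_self_sqrt (Real.sqrt_nonneg _)]

lemma sq_entryScale_mul (σ : Fin n → ℝ) (α : Fin n → ℕ) (i : Fin n) :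
    (entryScale α i * σ i) ^ 2 = entryVariance σ α i := by
  rw [mul_pow, entryScale, inv_pow, Real.sq_sqrt (Real.sqrt_nonneg _), entryVariance,
    div_eq_inv_mul]

/-- The tensors of the matrix product state, read off from independent standard Gaussians. -/
def scaledTensors (d : Fin n → ℕ) (σ : Fin n → ℝ) (α : Fin n → ℕ)
    (ω : Fin n × ℕ × ℕ × ℕ → ℝ) : Tensors d α :=
  fun e => entryScale α e.1 * σ e.1 * ω (e.1, e.2.1, e.2.2.1, e.2.2.2)

lemma measurable_scaledTensors (d : Fin n → ℕ) (σ : Fin n → ℝ) (α : Fin n → ℕ) :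
    Measurable (scaledTensors d σ α) := by
  unfold scaledTensors
  fun_prop

lemma map_scaledTensors (d : Fin n → ℕ) (σ : Fin n → ℝ) (α : Fin n → ℕ) :
    (stdGaussianFamily _).map (scaledTensors d σ α) =
      (tensorLaw d σ α : Measure (Tensors d α)) := by
  have hg : Function.Injective fun e : Entry d α =>
      ((e.1, (e.2.1 : ℕ), (e.2.2.1 : ℕ), (e.2.2.2 : ℕ)) : Fin n × ℕ × ℕ × ℕ) := by
    rintro ⟨i, s, a, b⟩ ⟨i', s', a', b'⟩ h
    simp only [Prod.mk.injEq] at h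
    obtain ⟨rfl, h1, h2, h3⟩ := h
    rw [Fin.ext h1, Fin.ext h2, Fin.ext h3]
  have hsc : scaledTensors d σ α =
      (fun (z : Entry d α → ℝ) e => entryScale α e.1 * σ e.1 * z e) ∘
        fun ω e => ω (e.1, (e.2.1 : ℕ), (e.2.2.1 : ℕ), (e.2.2.2 : ℕ)) := rfl
  have : ∀ e : Entry d α, IsProbabilityMeasure
      ((gaussianReal 0 1).map fun y => entryScale α e.1 * σ e.1 * y) := fun e =>
    Measure.isProbabilityMeasure_map (by fun_prop)
  rw [hsc, ← Measure.map_map (by fun_prop) (by fun_prop), map_comp_injective hg, stdGaussianFamily,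
    Measure.infinitePi_map_pi (fun _ => gaussianReal 0 1)
      (f := fun (e : Entry d α) y => entryScale α e.1 * σ e.1 * y) (fun e => by fun_prop),
    Measure.infinitePi_eq_pi]
  change _ = Measure.pi _
  congr 1
  ext1 e
  rw [gaussianReal_map_const_mul, mul_zero, mul_one]
  congr 1
  refine NNReal.eq ?_
  rw [← sq_entryScale_mul, Real.coe_toNNReal _ (sq_nonneg _)]
  rfl

lemma output_scaledTensors (φ : ∀ i, X i → Fin (d i) → ℝ) (σ : Fin n → ℝ)
    (x : Fin m → ∀ i, X i) (α : Fin n → ℕ) (ω : Fin n × ℕ × ℕ × ℕ → ℝ) (k : Fin m) :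
    output φ (scaledTensors d σ α ω) (x k) = (matrixProductState φ σ x).value α ω k := by
  have htensor : ∀ i a b, (matrixProductState φ σ x).tensor ω i k a b =
      ∑ s : Fin (d i), σ i * φ i (x k i) s * ω (i, s, a, b) := by
    intro i a b
    simp only [Network.tensor, matrixProductState]
    rw [Finset.sum_range]
    refine Finset.sum_congr rfl fun s _ => ?_
    simp only [s.2, dif_pos]
  have hbox : (matrixProductState φ σ x).box α =
      Fintype.piFinset fun i => Finset.range (α i) := by
    simp [Network.box, matrixProductState]
  unfold Network.value output
  rw [hbox]
  change _ = (∏ i, (√(α i : ℝ))⁻¹) * ∑ a ∈ _, ∏ i, _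
  rw [← prod_entryScale, ← sum_fin_eq_sum_piFinset, Finset.sum_comm, Finset.mul_sum]
  refine Finset.sum_congr rfl fun a _ => ?_
  simp_rw [htensor]
  rw [Finset.prod_univ_sum, Fintype.piFinset_univ, Finset.mul_sum]
  refine Finset.sum_congr rfl fun s _ => ?_
  rw [← Finset.prod_mul_distrib, ← Finset.prod_mul_distrib]
  refine Finset.prod_congr rfl fun i _ => ?_
  simp only [scaledTensors, matrixProductState]
  ring

lemma outputLaw_eq_law (φ : ∀ i, X i → Fin (d i) → ℝ) (σ : Fin n → ℝ)
    (x : Fin m → ∀ i, X i) (α : Fin n → ℕ) :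
    outputLaw φ σ x α = (matrixProductState φ σ x).law α := by
  apply Subtype.ext
  change Measure.map _ (tensorLaw d σ α : Measure (Tensors d α)) = Measure.map _ _
  rw [← map_scaledTensors, Measure.map_map (measurable_output φ α x)
    (measurable_scaledTensors d σ α)]
  congr 1
  ext ω k
  exact output_scaledTensors φ σ x α ω k

end MatrixProductState

/-! ### An explicit Gaussian process with the limit covariance. -/

section LimitProcess

variable {n : ℕ} {X : Fin n → Type*} {d : Fin n → ℕ} {m : ℕ}

/-- The coefficient of the product feature vector of `x`, scaled by the standard deviations. -/
def productFeature (φ : ∀ i, X i → Fin (d i) → ℝ) (σ : Fin n → ℝ) (x : ∀ i, X i)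
    (s : ∀ i, Fin (d i)) : ℝ :=
  ∏ i, σ i * φ i (x i) (s i)

/-- Expanding the product over sites exhibits `limitCov` as an inner product of product features. A
Gaussian process with this covariance is then a finite linear combination of independent standard
Gaussians. -/
lemma sum_productFeature_mul (φ : ∀ i, X i → Fin (d i) → ℝ) (σ : Fin n → ℝ) (x x' : ∀ i, X i) :
    ∑ s, productFeature φ σ x s * productFeature φ σ x' s = limitCov φ σ x x' := by
  simp only [productFeature, limitCov, dotProduct, Finset.mul_sum]
  rw [Finset.prod_univ_sum, Fintype.piFinset_univ]
  refine Finset.sum_congr rfl fun s _ => ?_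
  rw [← Finset.prod_mul_distrib]
  refine Finset.prod_congr rfl fun i _ => ?_
  ring

/-- The limit process, as a function of independent standard Gaussians indexed by the values of
the physical indices. -/
def limitProcess (φ : ∀ i, X i → Fin (d i) → ℝ) (σ : Fin n → ℝ) (x : ∀ i, X i)
    (z : (∀ i, Fin (d i)) → ℝ) : ℝ :=
  ∑ s, productFeature φ σ x s * z s

lemma measurable_limitProcess (φ : ∀ i, X i → Fin (d i) → ℝ) (σ : Fin n → ℝ) :
    Measurable fun (z : (∀ i, Fin (d i)) → ℝ) x => limitProcess φ σ x z := by
  unfold limitProcess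
  fun_prop

/-- The law of the limit process. -/
def limitLaw (φ : ∀ i, X i → Fin (d i) → ℝ) (σ : Fin n → ℝ) :
    ProbabilityMeasure ((∀ i, X i) → ℝ) :=
  ⟨(stdGaussianFamily _).map fun z x => limitProcess φ σ x z,
    Measure.isProbabilityMeasure_map (measurable_limitProcess φ σ).aemeasurable⟩

lemma isGaussianProcess_limitLaw (φ : ∀ i, X i → Fin (d i) → ℝ) (σ : Fin n → ℝ) :
    IsGaussianProcess (fun (x : ∀ i, X i) (ω : (∀ i, X i) → ℝ) => ω x)
      (limitLaw φ σ : Measure ((∀ i, X i) → ℝ)) where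
  hasGaussianLaw I := by
    have hproc : IsGaussianProcess (limitProcess φ σ) (stdGaussianFamily (∀ i, Fin (d i))) := by
      refine isGaussianProcess_eval.of_isGaussianProcess fun x => ⟨Finset.univ,
        ∑ s, productFeature φ σ x s •
          ContinuousLinearMap.proj (R := ℝ)
            (φ := fun _ : (Finset.univ : Finset (∀ i, Fin (d i))) => ℝ)
            ⟨s, Finset.mem_univ s⟩, fun z => ?_⟩
      simp [limitProcess]
    refine ⟨?_⟩
    change IsGaussian (Measure.map _ (Measure.map _ _))
    rw [Measure.map_map (by fun_prop) (measurable_limitProcess φ σ)]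
    exact (hproc.hasGaussianLaw I).isGaussian_map

lemma integral_limitLaw (φ : ∀ i, X i → Fin (d i) → ℝ) (σ : Fin n → ℝ) (x : ∀ i, X i) :
    ∫ ω, ω x ∂(limitLaw φ σ : Measure ((∀ i, X i) → ℝ)) = 0 :=
  (integral_map (measurable_limitProcess φ σ).aemeasurable
    (Measurable.aestronglyMeasurable (by fun_prop))).trans
    (integral_linear Finset.univ id (productFeature φ σ x))

lemma covariance_limitLaw (φ : ∀ i, X i → Fin (d i) → ℝ) (σ : Fin n → ℝ) (x x' : ∀ i, X i) :
    covariance (fun ω => ω x) (fun ω => ω x') (limitLaw φ σ : Measure ((∀ i, X i) → ℝ)) =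
      limitCov φ σ x x' := by
  rw [← sum_productFeature_mul, ← covariance_linear (ι := ∀ i, Fin (d i)) Finset.univ
    (g := id) Function.injective_id]
  exact covariance_map (Measurable.aestronglyMeasurable (by fun_prop))
    (Measurable.aestronglyMeasurable (by fun_prop)) (measurable_limitProcess φ σ).aemeasurable

/-- Identifies the finite-dimensional laws of the process in the form `Network.seqTendsto_law`
requires of its limit. -/
lemma integral_cexp_limitLaw (φ : ∀ i, X i → Fin (d i) → ℝ) (σ : Fin n → ℝ)
    (x : Fin m → ∀ i, X i) (t : Fin m → ℝ) :
    ∫ y : Fin m → ℝ, Complex.exp (((∑ k, t k * y k : ℝ) : ℂ) * Complex.I)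
        ∂((limitLaw φ σ).map (measurable_eval x).aemeasurable : Measure (Fin m → ℝ)) =
      Complex.exp ((-((∑ k, ∑ k', t k * t k' * limitCov φ σ (x k) (x k')) / 2) : ℝ)) := by
  have hlin : ∀ z, ∑ k, t k * limitProcess φ σ (x k) z =
      ∑ s, (∑ k, t k * productFeature φ σ (x k) s) * z (id s) := by
    intro z
    simp_rw [limitProcess, Finset.mul_sum, Finset.sum_mul]
    rw [Finset.sum_comm]
    simp_rw [id, mul_assoc]
  have hvar : ∑ s, (∑ k, t k * productFeature φ σ (x k) s) ^ 2 =
      ∑ k, ∑ k', t k * t k' * limitCov φ σ (x k) (x k') := by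
    simp_rw [sq, Finset.sum_mul_sum, ← sum_productFeature_mul, Finset.mul_sum]
    rw [Finset.sum_comm]
    refine Finset.sum_congr rfl fun k _ => ?_
    rw [Finset.sum_comm]
    refine Finset.sum_congr rfl fun k' _ => Finset.sum_congr rfl fun s _ => ?_
    ring
  rw [← hvar, ← integral_cexp_linear (ι := ∀ i, Fin (d i)) Finset.univ Function.injective_id]
  simp_rw [← hlin]
  have h1 : ((limitLaw φ σ).map (measurable_eval x).aemeasurable : Measure (Fin m → ℝ)) =
      (stdGaussianFamily _).map fun z k => limitProcess φ σ (x k) z :=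
    Measure.map_map (measurable_eval x) (measurable_limitProcess φ σ)
  rw [h1]
  exact integral_map ((measurable_eval x).comp (measurable_limitProcess φ σ)).aemeasurable
    (Measurable.aestronglyMeasurable (by fun_prop))

end LimitProcess

end MPS

end

theorem theorem1 {n : ℕ} [NeZero n] {X : Fin n → Type*} {d : Fin n → ℕ}
    (φ : ∀ i, X i → Fin (d i) → ℝ) (σ : Fin n → ℝ) :
    ∃ P : ProbabilityMeasure ((∀ i, X i) → ℝ),
      IsGaussianProcess (fun (x : ∀ i, X i) (ω : (∀ i, X i) → ℝ) => ω x)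
        (P : Measure ((∀ i, X i) → ℝ)) ∧
      (∀ x : ∀ i, X i, ∫ ω, ω x ∂(P : Measure ((∀ i, X i) → ℝ)) = 0) ∧
      (∀ x x' : ∀ i, X i,
        covariance (fun ω => ω x) (fun ω => ω x') (P : Measure ((∀ i, X i) → ℝ)) =
          MPS.limitCov φ σ x x') ∧
      ∀ l : List (Fin n), l.Nodup → (∀ i, i ∈ l) →
        ∀ (m : ℕ) (x : Fin m → ∀ i, X i),
          MPS.SeqTendsto l (MPS.outputLaw φ σ x)
            (P.map (MPS.measurable_eval x).aemeasurable) := by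
  refine ⟨MPS.limitLaw φ σ, MPS.isGaussianProcess_limitLaw φ σ, MPS.integral_limitLaw φ σ,
    MPS.covariance_limitLaw φ σ, fun l hl hmem m x => ?_⟩
  have hf : MPS.outputLaw φ σ x = (MPS.matrixProductState φ σ x).law :=
    funext fun α => MPS.outputLaw_eq_law φ σ x α
  rw [hf]
  exact MPS.Network.seqTendsto_law (MPS.integral_cexp_limitLaw φ σ x) l _
    (List.ne_nil_of_mem (hmem 0)) hl
    (Finset.eq_univ_of_forall fun i => List.mem_toFinset.2 (hmem i))
    (MPS.isCycle_matrixProductState φ σ x) (MPS.prod_gram_matrixProductState φ σ x)
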